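/- Let $E$ be a meet-semilattice with unit $1$ and zero $0$ (homomorphisms of such semilattices preserve products, unit and zero). Let $\hat E$ be the set of characters of $E$, that is, of homomorphisms $\varphi\colon E\to\{0,1\}$, with the topology generated by the sets $U_e=\{\varphi\in\hat E:\varphi(e)=1\}$ for $e\in E$. Let $A$ be a $C^*$-algebra and let $\operatorname{Prim}A$ be its primitive ideal space with the hull-kernel topology. An action of $E$ on $A$ is a homomorphism from $E$ to the semilattice of closed two-sided ideals of $A$ (with intersection as product, unit $A$ and zero $\{0\}$). A structure of $C^*$-algebra over a topological space $X$ on $A$ is a continuous map $\psi\colon\operatorname{Prim}A\to X$; for $U\subseteq X$ open, $A(U)$ denotes the ideal of $A$ corresponding to the open subset $\psi^{-1}(U)$, that is, $A(U)=\bigcap\{P\in\operatorname{Prim}A : \psi(P)\notin U\}$ (with $A(U)=A$ if there is no such $P$). Then an action of $E$ on $A$ is equivalent to a structure of $C^*$-algebra over $\hat E$ on $A$: there is a bijection between actions $\alpha$ of $E$ on $A$ and continuous maps $\psi\colon\operatorname{Prim}A\to\hat E$, which sends $\alpha$ to the map $\psi$ with $\psi(P)(e)=1$ if $\alpha(e)\not\subseteq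 P$ and $\psi(P)(e)=0$ otherwise, and whose inverse sends $\psi$ to the action $e\mapsto A(U_e)$. -/

import Mathlib

/-! ### Semilattices with unit and zero, their characters -/

/-- A homomorphism of meet-semilattices with unit `⊤` and zero `⊥`: it preserves products
(that is, meets), the unit and the zero. -/
structure SemilatticeHom (E F : Type*) [SemilatticeInf E] [BoundedOrder E]
    [SemilatticeInf F] [BoundedOrder F] where
  /-- The underlying map. -/
  toFun : E → F
  map_inf' : ∀ e f : E, toFun (e ⊓ f) = toFun e ⊓ toFun f
  map_top' : toFun ⊤ = ⊤
  map_bot' : toFun ⊥ = ⊥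

instance SemilatticeHom.instFunLike (E F : Type*) [SemilatticeInf E] [BoundedOrder E]
    [SemilatticeInf F] [BoundedOrder F] : FunLike (SemilatticeHom E F) E F where
  coe := SemilatticeHom.toFun
  coe_injective := by
    rintro ⟨f, _, _, _⟩ ⟨g, _, _, _⟩ h
    congr

/-- The character space of a semilattice: homomorphisms to the two-element semilattice
`{0, 1} = {false, true}`. -/
abbrev CharacterSpace (E : Type*) [SemilatticeInf E] [BoundedOrder E] : Type _ :=
  SemilatticeHom E Bool

/-- The topology on the character space generated by the sets `U_e = {φ | φ e = 1}`. -/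
instance CharacterSpace.instTopologicalSpace (E : Type*) [SemilatticeInf E] [BoundedOrder E] :
    TopologicalSpace (CharacterSpace E) :=
  TopologicalSpace.generateFrom {V | ∃ e : E, V = {φ : CharacterSpace E | φ e = true}}

/-- The open subset `U_e = {φ | φ e = 1}` of the character space. -/
def CharacterSpace.basicOpen {E : Type*} [SemilatticeInf E] [BoundedOrder E] (e : E) :
    TopologicalSpace.Opens (CharacterSpace E) :=
  ⟨{φ : CharacterSpace E | φ e = true}, TopologicalSpace.isOpen_generateFrom_of_mem ⟨e, rfl⟩⟩

/-! ### Closed two-sided ideals -/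

section ClosedIdeals

universe u

variable (A : Type u) [NonUnitalCStarAlgebra A]

/-- An ideal of a C⋆-algebra, in the usual sense: a norm-closed two-sided ideal. -/
structure CStarIdeal extends Submodule ℂ A where
  mul_mem_left' : ∀ (a : A) {x : A}, x ∈ carrier → a * x ∈ carrier
  mul_mem_right' : ∀ (a : A) {x : A}, x ∈ carrier → x * a ∈ carrier
  isClosed' : IsClosed carrier

variable {A}

namespace CStarIdeal

instance : SetLike (CStarIdeal A) A where
  coe I := I.carrier
  coe_injective := by
    rintro ⟨I, _, _, _⟩ ⟨J, _, _, _⟩ h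
    congr
    exact SetLike.coe_injective h

/-- Ideals are ordered by inclusion. -/
instance : PartialOrder (CStarIdeal A) := PartialOrder.ofSetLike (CStarIdeal A) A

/-- The intersection of a set of ideals. -/
instance : InfSet (CStarIdeal A) where
  sInf S :=
    { carrier := {x | ∀ I ∈ S, x ∈ I}
      add_mem' := fun hx hy I hI => I.add_mem' (hx I hI) (hy I hI)
      zero_mem' := fun I _ => I.zero_mem'
      smul_mem' := fun c _ hx I hI => I.smul_mem' c (hx I hI)
      mul_mem_left' := fun a _ hx I hI => I.mul_mem_left' a (hx I hI)
      mul_mem_right' := fun a _ hx I hI => I.mul_mem_right' a (hx I hI)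
      isClosed' := by
        have h : {x : A | ∀ I ∈ S, x ∈ I} = ⋂ I ∈ S, (I : Set A) := by
          ext x
          simp
        rw [h]
        exact isClosed_biInter fun I _ => I.isClosed' }

/-- The semilattice of ideals; the product of two ideals is their intersection. -/
instance : SemilatticeInf (CStarIdeal A) where
  inf I J :=
    { toSubmodule := I.toSubmodule ⊓ J.toSubmodule
      mul_mem_left' := fun a _ hx => ⟨I.mul_mem_left' a hx.1, J.mul_mem_left' a hx.2⟩
      mul_mem_right' := fun a _ hx => ⟨I.mul_mem_right' a hx.1, J.mul_mem_right' a hx.2⟩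
      isClosed' := I.isClosed'.inter J.isClosed' }
  inf_le_left _ _ := fun _ hx => hx.1
  inf_le_right _ _ := fun _ hx => hx.2
  le_inf _ _ _ h₁ h₂ := fun _ hx => ⟨h₁ hx, h₂ hx⟩

/-- The unit of the semilattice of ideals is `A`, its zero is `{0}`. -/
instance : BoundedOrder (CStarIdeal A) where
  top :=
    { toSubmodule := ⊤
      mul_mem_left' := fun _ _ _ => trivial
      mul_mem_right' := fun _ _ _ => trivial
      isClosed' := isClosed_univ }
  le_top _ := fun _ _ => trivial
  bot :=
    { toSubmodule := ⊥
      mul_mem_left' := fun a x hx => by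
        have hx' : x = 0 := hx
        subst hx'
        exact mul_zero a
      mul_mem_right' := fun a x hx => by
        have hx' : x = 0 := hx
        subst hx'
        exact zero_mul a
      isClosed' := isClosed_singleton }
  bot_le I := fun x hx => by
    have hx' : x = 0 := hx
    subst hx'
    exact I.zero_mem'

end CStarIdeal

/-! ### The primitive ideal space -/

/-- A ⋆-representation on a Hilbert space is irreducible if it is nonzero and its only closed
invariant subspaces are the trivial ones. -/
def IsIrreducibleRep {H : Type*} [NormedAddCommGroup H] [InnerProductSpace ℂ H]
    [CompleteSpace H] (π : A →⋆ₙₐ[ℂ] (H →L[ℂ] H)) : Prop :=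
  π ≠ 0 ∧ ∀ K : Submodule ℂ H, IsClosed (K : Set H) → (∀ a : A, ∀ x ∈ K, π a x ∈ K) →
    K = ⊥ ∨ K = ⊤

/-- An ideal is primitive if it is the kernel of an irreducible ⋆-representation. Irreducible
representations are cyclic, so each one is unitarily equivalent to one on a Hilbert space in the
universe of `A` (a completion of a quotient of `A`). -/
def CStarIdeal.IsPrimitive (P : CStarIdeal A) : Prop :=
  ∃ (H : Type u) (_ : NormedAddCommGroup H) (_ : InnerProductSpace ℂ H) (_ : CompleteSpace H)
    (π : A →⋆ₙₐ[ℂ] (H →L[ℂ] H)), IsIrreducibleRep π ∧ ∀ a : A, a ∈ P ↔ π a = 0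

theorem CStarIdeal.IsPrimitive.not_top_le {P : CStarIdeal A} (hP : P.IsPrimitive) :
    ¬ (⊤ : CStarIdeal A) ≤ P := by
  obtain ⟨H, _, _, _, π, ⟨h0, _⟩, hk⟩ := hP
  intro h
  exact h0 (DFunLike.ext _ _ fun a => (hk a).1 (h (show a ∈ (⊤ : CStarIdeal A) from trivial)))

/-- Primitive ideals are prime. -/
theorem CStarIdeal.IsPrimitive.le_or_le {P : CStarIdeal A} (hP : P.IsPrimitive)
    {I J : CStarIdeal A} (h : I ⊓ J ≤ P) : I ≤ P ∨ J ≤ P := by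
  obtain ⟨H, _, _, _, π, ⟨_, hirr⟩, hk⟩ := hP
  by_contra hcon
  rw [not_or] at hcon
  obtain ⟨hI, hJ⟩ := hcon
  apply hJ
  intro j hj
  rw [hk]
  -- the closed linear span of `π(I)H`
  let K₀ : Submodule ℂ H := Submodule.span ℂ {y | ∃ i ∈ I, ∃ x : H, y = π i x}
  have hinv : ∀ a : A, ∀ x ∈ K₀.topologicalClosure, π a x ∈ K₀.topologicalClosure := by
    intro a x hx
    have h1 : K₀ ≤ K₀.topologicalClosure.comap (π a : H →ₗ[ℂ] H) := by
      refine Submodule.span_le.2 ?_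
      rintro _ ⟨i, hi, x, rfl⟩
      refine K₀.le_topologicalClosure (Submodule.subset_span ⟨a * i, I.mul_mem_left' a hi, x, ?_⟩)
      simp
    have h2 : IsClosed ((K₀.topologicalClosure.comap (π a : H →ₗ[ℂ] H) : Submodule ℂ H) : Set H) :=
      K₀.isClosed_topologicalClosure.preimage (π a).continuous
    exact K₀.topologicalClosure_minimal h1 h2 hx
  rcases hirr _ K₀.isClosed_topologicalClosure hinv with hbot | htop
  · exfalso
    apply hI
    intro i hi
    rw [hk]
    ext x
    have : π i x ∈ K₀.topologicalClosure :=
      K₀.le_topologicalClosure (Submodule.subset_span ⟨i, hi, x, rfl⟩)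
    rw [hbot] at this
    simpa using this
  · have h1 : K₀ ≤ LinearMap.ker (π j : H →ₗ[ℂ] H) := by
      refine Submodule.span_le.2 ?_
      rintro _ ⟨i, hi, x, rfl⟩
      have hm : j * i ∈ P := h ⟨I.mul_mem_left' j hi, J.mul_mem_right' i hj⟩
      rw [hk, map_mul] at hm
      have := congrArg (fun T : H →L[ℂ] H => T x) hm
      simpa using this
    have h2 : IsClosed ((LinearMap.ker (π j : H →ₗ[ℂ] H) : Submodule ℂ H) : Set H) :=
      isClosed_singleton.preimage (π j).continuous
    have h3 := K₀.topologicalClosure_minimal h1 h2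
    rw [htop] at h3
    ext x
    simpa using h3 (show x ∈ (⊤ : Submodule ℂ H) from trivial)

variable (A) in
/-- The set of primitive ideals of `A`. -/
def PrimitiveIdealSpace : Type u := {P : CStarIdeal A // P.IsPrimitive}

namespace PrimitiveIdealSpace

/-- The intersection of the primitive ideals in `S`; it is `A` if `S` is empty. -/
def kernel (S : Set (PrimitiveIdealSpace A)) : CStarIdeal A :=
  sInf (Subtype.val '' S)

theorem kernel_le {S : Set (PrimitiveIdealSpace A)} {P : PrimitiveIdealSpace A} (hP : P ∈ S) :
    kernel S ≤ P.1 :=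
  fun _ hx => hx P.1 ⟨P, hP, rfl⟩

theorem le_kernel {S : Set (PrimitiveIdealSpace A)} {I : CStarIdeal A}
    (h : ∀ P ∈ S, I ≤ P.1) : I ≤ kernel S := by
  rintro x hx _ ⟨P, hP, rfl⟩
  exact h P hP hx

/-- The hull-kernel (Jacobson) topology: a set `C` of primitive ideals is closed if and only if it
contains each primitive ideal `P` with `⋂ C ⊆ P`. -/
instance : TopologicalSpace (PrimitiveIdealSpace A) where
  IsOpen U := ∀ P : PrimitiveIdealSpace A, kernel Uᶜ ≤ P.1 → P ∈ Uᶜ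
  isOpen_univ P hP := by
    exact absurd ((le_kernel (by simp)).trans hP) P.2.not_top_le
  isOpen_inter U V hU hV P hP := by
    rw [Set.compl_inter] at hP ⊢
    have h : kernel Uᶜ ⊓ kernel Vᶜ ≤ P.1 := by
      refine le_trans (le_kernel ?_) hP
      rintro Q (hQ | hQ)
      · exact inf_le_left.trans (kernel_le hQ)
      · exact inf_le_right.trans (kernel_le hQ)
    exact (P.2.le_or_le h).imp (hU P) (hV P)
  isOpen_sUnion S hS P hP := by
    rintro ⟨U, hU, hPU⟩
    refine hS U hU P (le_trans (le_kernel ?_) hP) hPU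
    intro Q hQ
    exact kernel_le fun hQU => hQ ⟨U, hU, hQU⟩

end PrimitiveIdealSpace

/-! ### Actions of semilattices and of spaces on a C⋆-algebra -/

/-- An action of a semilattice `E` with unit and zero on `A`: a unit- and zero-preserving
homomorphism from `E` to the semilattice of ideals of `A`. -/
abbrev SemilatticeAction (E : Type*) [SemilatticeInf E] [BoundedOrder E] (A : Type u)
    [NonUnitalCStarAlgebra A] : Type _ :=
  SemilatticeHom E (CStarIdeal A)

/-- A structure of C⋆-algebra over the topological space `X` on `A` (an action of `X` on `A`):
a continuous map from the primitive ideal space of `A` to `X`. -/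
abbrev CStarAlgebraOver (X : Type*) [TopologicalSpace X] (A : Type u)
    [NonUnitalCStarAlgebra A] : Type _ :=
  C(PrimitiveIdealSpace A, X)

/-- The ideal `A(U)` of a C⋆-algebra over `X`, for `U` open in `X`: the ideal that corresponds to
the open subset `ψ⁻¹(U)` of the primitive ideal space, that is, the intersection of all primitive
ideals outside `ψ⁻¹(U)`. -/
def CStarAlgebraOver.idealOver {X : Type*} [TopologicalSpace X] (ψ : CStarAlgebraOver X A)
    (U : TopologicalSpace.Opens X) : CStarIdeal A :=
  PrimitiveIdealSpace.kernel (ψ ⁻¹' (U : Set X))ᶜ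

end ClosedIdeals

/-!
The two constructions are inverse to each other for formal reasons once every closed ideal `I` is
known to be the intersection of the primitive ideals containing it (`CStarIdeal.kernel_setOf_le`).
Indeed, primitive ideals being prime, `e ↦ [α(e) ⊄ P]` is a character, and it depends continuously
on `P` because `{P | α(e) ⊄ P}` is open in the hull-kernel topology. Conversely `e ↦ A(U_e)` is
compatible with meets since the kernel of a union is the intersection of the kernels, and it
preserves zero since the intersection of all primitive ideals is `0`. The composites are the
identities because `α(e)` is the intersection of the `P ⊇ α(e)`, and because, for an open set `U`
of primitive ideals, `P ∈ U` if and only if `⋂ Uᶜ ⊄ P`.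

The analytic input is that an element `a` outside a closed ideal `I` is not in some primitive ideal
containing `I`. Passing to the unitization, one may assume the algebra unital. An approximate unit
argument (`CStarIdeal.exists_norm_mul_one_sub_le`) shows that `-a⋆a` is not in the closure of the
cone generated by positive elements, `I` and skew-adjoint elements, so Hahn–Banach separation gives
a state that vanishes on `I` but not at `a⋆a`. The states vanishing on `I` form a weak-⋆ compact
convex set, so by the Krein–Milman theorem an extreme one is nonzero at `a⋆a`. Its GNS
representation vanishes on `I` but not at `a`, and extremality makes it irreducible
(`CStarIdeal.isIrreducibleRep_of_mem_extremePoints`).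
-/

open scoped ComplexOrder InnerProductSpace

section Unital

variable {B : Type*} [CStarAlgebra B]

/-! ### States that vanish on an ideal -/

namespace CStarIdeal

/-- A closed ideal contains approximate right units for each of its elements `j`: with `x = j⋆j`
one takes `u = x (δ + x)⁻¹`, so that `1 - u = δ (δ + x)⁻¹`. Only the algebraic ideal property is
needed for `u ∈ J`; in particular `J` is not assumed to be closed under `star`. -/
theorem exists_norm_mul_one_sub_le (J : CStarIdeal B) {j : B} (hj : j ∈ J) {δ : ℝ} (hδ : 0 < δ) :
    ∃ u ∈ J, IsSelfAdjoint u ∧ ‖1 - u‖ ≤ 1 ∧ ‖j * (1 - u)‖ ^ 2 ≤ δ := by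
  let _ := CStarAlgebra.spectralOrder B
  have := CStarAlgebra.spectralOrderedRing B
  have hx : 0 ≤ star j * j := star_mul_self_nonneg j
  have hxJ : star j * j ∈ J := J.mul_mem_left' _ hj
  have hpos : ∀ t ∈ spectrum ℝ (star j * j), 0 ≤ t := fun t ht => spectrum_nonneg_of_nonneg hx ht
  have hne : ∀ t ∈ spectrum ℝ (star j * j), δ + t ≠ 0 := fun t ht => by
    have := hpos t ht
    positivity
  have hc₁ : ContinuousOn (fun t : ℝ => (δ + t)⁻¹) (spectrum ℝ (star j * j)) :=
    ContinuousOn.inv₀ (by fun_prop) hne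
  have hc₂ : ContinuousOn (fun t : ℝ => δ * (δ + t)⁻¹) (spectrum ℝ (star j * j)) := by fun_prop
  have hu : 1 - star j * j * cfc (fun t : ℝ => (δ + t)⁻¹) (star j * j)
      = cfc (fun t : ℝ => δ * (δ + t)⁻¹) (star j * j) := by
    nth_rewrite 1 [← cfc_id ℝ (star j * j)]
    rw [← cfc_mul _ _ _ (by fun_prop) hc₁, ← cfc_one ℝ (star j * j),
      ← cfc_sub _ _ _ (by fun_prop) (by fun_prop)]
    refine cfc_congr fun t ht => ?_
    have := hne t ht
    simp only [id, Pi.one_apply]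
    field_simp
    ring
  have hv : IsSelfAdjoint (cfc (fun t : ℝ => δ * (δ + t)⁻¹) (star j * j)) := cfc_predicate _ _
  refine ⟨star j * j * cfc (fun t : ℝ => (δ + t)⁻¹) (star j * j),
    J.mul_mem_right' _ hxJ, ?_, ?_, ?_⟩
  · have h := (IsSelfAdjoint.one B).sub hv
    rwa [← hu, sub_sub_cancel] at h
  · rw [hu]
    refine norm_cfc_le zero_le_one fun t ht => ?_
    have h := hpos t ht
    rw [Real.norm_of_nonneg (by positivity), ← div_eq_mul_inv, div_le_one (by positivity)]
    linarith
  · rw [hu, sq, ← CStarRing.norm_star_mul_self, star_mul, hv.star_eq, mul_assoc, ← mul_assoc (star j)]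
    nth_rewrite 2 [← cfc_id ℝ (star j * j)]
    rw [← cfc_mul _ _ _ (by fun_prop) hc₂, ← cfc_mul _ _ _ hc₂ (by fun_prop)]
    refine norm_cfc_le hδ.le fun t ht => ?_
    have h := hpos t ht
    simp only [id]
    rw [Real.norm_of_nonneg (by positivity)]
    have h1 : δ * (δ + t)⁻¹ ≤ 1 := by
      rw [← div_eq_mul_inv, div_le_one (by positivity)]
      linarith
    have h2 : t * (δ + t)⁻¹ ≤ 1 := by
      rw [← div_eq_mul_inv, div_le_one (by positivity)]
      linarith
    calc δ * (δ + t)⁻¹ * (t * (δ * (δ + t)⁻¹))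
        = δ * ((δ * (δ + t)⁻¹) * (t * (δ + t)⁻¹)) := by ring
      _ ≤ δ * (1 * 1) := by gcongr
      _ = δ := by ring

/-- The real cone of elements whose real part is positive modulo the real part of `J`, that is,
`B₊ + J + {s | s⋆ = -s}`. Including the skew-adjoint elements allows real separation theorems to be
applied in `B` itself, rather than in its self-adjoint part. -/
def positiveModCone (J : CStarIdeal B) : PointedCone ℝ B where
  carrier := {x | ∃ p, ∃ j ∈ J, ∃ s, star s = -s ∧ x = star p * p + j + s}
  zero_mem' := ⟨0, 0, J.zero_mem', 0, by simp, by simp⟩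
  add_mem' := by
    let _ := CStarAlgebra.spectralOrder B
    have := CStarAlgebra.spectralOrderedRing B
    rintro _ _ ⟨p, j, hj, s, hs, rfl⟩ ⟨q, k, hk, t, ht, rfl⟩
    obtain ⟨r, hr⟩ := CStarAlgebra.nonneg_iff_eq_star_mul_self.1
      (add_nonneg (star_mul_self_nonneg p) (star_mul_self_nonneg q))
    refine ⟨r, j + k, J.add_mem' hj hk, s + t, by rw [star_add, hs, ht]; abel, ?_⟩
    rw [← hr]
    abel
  smul_mem' := by
    rintro ⟨c, hc⟩ _ ⟨p, j, hj, s, hs, rfl⟩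
    refine ⟨√c • p, c • j, J.smul_mem' (c : ℂ) hj, c • s, by simp [hs], ?_⟩
    rw [star_smul, smul_mul_smul_comm, star_trivial (√c), Real.mul_self_sqrt hc, ← smul_add,
      ← smul_add]
    rfl

/-- If `a⋆a + p⋆p + j + s` is small, with `j ∈ J` and `s` skew-adjoint, then compressing its real
part by `v = 1 - u`, where `u ∈ J` is an approximate right unit for `j`, shows that
`(av)⋆(av)` is small. Then `a` is close to `au ∈ J`. -/
theorem neg_star_mul_self_notMem_closure (J : CStarIdeal B) {a : B} (ha : a ∉ J) :
    -(star a * a) ∉ closure (J.positiveModCone : Set B) := by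
  let _ := CStarAlgebra.spectralOrder B
  have := CStarAlgebra.spectralOrderedRing B
  intro hcl
  have ha' : a ∈ closure (J : Set B) := by
    rw [Metric.mem_closure_iff]
    intro ε hε
    obtain ⟨_, ⟨p, j, hj, s, hs, rfl⟩, hd⟩ :=
      Metric.mem_closure_iff.1 hcl (ε ^ 2 / 4) (by positivity)
    obtain ⟨u, hu, husa, hu1, huj⟩ := J.exists_norm_mul_one_sub_le hj
      (δ := (ε ^ 2 / 4) ^ 2) (by positivity)
    have huj' : ‖j * (1 - u)‖ ≤ ε ^ 2 / 4 := abs_le_of_sq_le_sq' huj (by positivity) |>.2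
    refine ⟨a * u, J.mul_mem_left' a hu, ?_⟩
    rw [dist_eq_norm]
    have hau : a - a * u = a * (1 - u) := by noncomm_ring
    rw [hau]
    set v := 1 - u with hv
    have hvsa : star v = v := by rw [hv, star_sub, star_one, husa.star_eq]
    set y := star a * a + (star p * p + j + s) with hy
    have hyn : ‖y‖ < ε ^ 2 / 4 := by
      rwa [dist_eq_norm, ← norm_neg, neg_sub, sub_neg_eq_add, add_comm] at hd
    have hconj : ∀ z : B, ‖v * z‖ ≤ ‖z‖ := fun z =>
      (norm_mul_le _ _).trans (mul_le_of_le_one_left (norm_nonneg _) hu1)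
    have hconj' : ∀ z : B, ‖z * v‖ ≤ ‖z‖ := fun z =>
      (norm_mul_le _ _).trans (mul_le_of_le_one_right (norm_nonneg _) hu1)
    have hle : (2 : ℝ) • (v * (star a * a) * v)
        ≤ v * (y + star y) * v - (v * (j * v) + star (v * (j * v))) := by
      have h0 : 0 ≤ (2 : ℝ) • (star (p * v) * (p * v)) :=
        smul_nonneg zero_le_two (star_mul_self_nonneg _)
      rw [← sub_nonneg]
      convert h0 using 1
      simp only [hy, star_add, star_mul, star_star, hs, hvsa, two_smul]
      noncomm_ring
    have h0 : 0 ≤ v * (star a * a) * v := by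
      have := star_mul_self_nonneg (a * v)
      rwa [star_mul, hvsa, mul_assoc, ← mul_assoc (star a), ← mul_assoc] at this
    have hn := CStarAlgebra.norm_le_norm_of_nonneg_of_le (smul_nonneg zero_le_two h0) hle
    have h1 : ‖v * (y + star y) * v‖ ≤ ‖y‖ + ‖y‖ :=
      (hconj' _).trans ((hconj _).trans ((norm_add_le _ _).trans (by rw [norm_star])))
    have h2 : ‖v * (j * v) + star (v * (j * v))‖ ≤ ε ^ 2 / 4 + ε ^ 2 / 4 := by
      refine (norm_add_le _ _).trans ?_
      rw [norm_star]
      have := (hconj (j * v)).trans huj'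
      linarith
    have h3 := hn.trans (norm_sub_le _ _)
    rw [norm_smul, Real.norm_of_nonneg zero_le_two] at h3
    have h4 : v * (star a * a) * v = star (a * v) * (a * v) := by
      rw [star_mul, hvsa]; noncomm_ring
    rw [h4, CStarRing.norm_star_mul_self] at h3
    nlinarith [norm_nonneg (a * v)]
  exact ha (J.isClosed'.closure_subset ha')

/-- The states of `B` that vanish on `J`, as a subset of the weak-⋆ dual. Positivity is tested on
the elements `x⋆x`, so that no order on `B` has to be chosen. -/
def states (J : CStarIdeal B) : Set (WeakDual ℂ B) :=
  {φ | φ 1 = 1 ∧ (∀ x, 0 ≤ φ (star x * x)) ∧ ∀ j ∈ J, φ j = 0}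

/-- Hahn–Banach separation of `-a⋆a` from the closed cone generated by `B₊`, `J` and the
skew-adjoint elements gives a real functional; its complexification is the desired state up to
normalization. -/
theorem exists_mem_states (J : CStarIdeal B) {a : B} (ha : a ∉ J) :
    ∃ φ ∈ J.states, φ (star a * a) ≠ 0 := by
  let _ := CStarAlgebra.spectralOrder B
  have := CStarAlgebra.spectralOrderedRing B
  obtain ⟨g, hg, hga⟩ := ProperCone.hyperplane_separation_point
    (⟨J.positiveModCone.closure, isClosed_closure⟩ : ProperCone ℝ B)
    (x₀ := -(star a * a)) (J.neg_star_mul_self_notMem_closure ha)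
  have hgK : ∀ x ∈ J.positiveModCone, 0 ≤ g x := fun x hx => hg x (subset_closure hx)
  have hpos : ∀ x, 0 ≤ g (star x * x) := fun x =>
    hgK _ ⟨x, 0, J.zero_mem', 0, by simp, by simp⟩
  have hJ0 : ∀ j ∈ J, 0 ≤ g j := fun j hj => hgK _ ⟨0, j, hj, 0, by simp, by simp⟩
  have hJ : ∀ j ∈ J, g j = 0 := fun j hj =>
    le_antisymm (by simpa using hJ0 (-j) (J.toSubmodule.neg_mem hj)) (hJ0 j hj)
  have hS0 : ∀ s, star s = -s → 0 ≤ g s := fun s hs =>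
    hgK _ ⟨0, 0, J.zero_mem', s, hs, by simp⟩
  have hS : ∀ s, star s = -s → g s = 0 := fun s hs =>
    le_antisymm (by simpa using hS0 (-s) (by simp [hs])) (hS0 s hs)
  let f : StrongDual ℂ B := g.extendRCLike
  have hf : ∀ x, f x = (g x : ℂ) - Complex.I * (g (Complex.I • x) : ℂ) := fun x =>
    g.extendRCLike_apply x
  have hfsa : ∀ x, IsSelfAdjoint x → f x = g x := fun x hx => by
    rw [hf, hS (Complex.I • x) (by simp [hx.star_eq])]
    simp
  have hfpos : ∀ x, 0 ≤ f (star x * x) := fun x => by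
    rw [hfsa _ (.star_mul_self x)]
    exact_mod_cast hpos x
  have hfa : 0 < g (star a * a) := by simpa using hga
  have h1 : 0 < g 1 := by
    have hle : star a * a ≤ algebraMap ℝ B ‖star a * a‖ :=
      IsSelfAdjoint.le_algebraMap_norm_self (.star_mul_self a)
    obtain ⟨r, hr⟩ := CStarAlgebra.nonneg_iff_eq_star_mul_self.1 (sub_nonneg.2 hle)
    have h := hpos r
    rw [← hr, map_sub, Algebra.algebraMap_eq_smul_one, map_smul, smul_eq_mul] at h
    by_contra! hcon
    nlinarith [norm_nonneg (star a * a)]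
  have hf1 : f 1 = g 1 := hfsa 1 (.one B)
  refine ⟨StrongDual.toWeakDual (((g 1 : ℂ)⁻¹) • f), ⟨?_, fun x => ?_, fun j hj => ?_⟩, ?_⟩
  · change (g 1 : ℂ)⁻¹ * f 1 = 1
    rw [hf1]
    exact inv_mul_cancel₀ (by exact_mod_cast h1.ne')
  · change 0 ≤ (g 1 : ℂ)⁻¹ * f (star x * x)
    refine mul_nonneg ?_ (hfpos x)
    rw [← Complex.ofReal_inv]
    exact_mod_cast (inv_pos.2 h1).le
  · change (g 1 : ℂ)⁻¹ * f j = 0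
    rw [hf, hJ j hj, hJ (Complex.I • j) (J.smul_mem' _ hj)]
    simp
  · change (g 1 : ℂ)⁻¹ * f (star a * a) ≠ 0
    rw [hfsa _ (.star_mul_self a)]
    exact_mod_cast (mul_pos (inv_pos.2 h1) hfa).ne'

theorem convex_states (J : CStarIdeal B) : Convex ℝ J.states := by
  rintro φ ⟨h1, h2, h3⟩ ψ ⟨k1, k2, k3⟩ s t hs ht hst
  have h : ∀ x, (s • φ + t • ψ) x = (s : ℂ) * φ x + (t : ℂ) * ψ x := fun x => rfl
  refine ⟨?_, fun x => ?_, fun j hj => ?_⟩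
  · rw [h, h1, k1]
    exact_mod_cast (by simpa using hst)
  · rw [h]
    exact add_nonneg (mul_nonneg (by exact_mod_cast hs) (h2 x))
      (mul_nonneg (by exact_mod_cast ht) (k2 x))
  · rw [h, h3 j hj, k3 j hj]
    simp

end CStarIdeal

/-! ### Cyclic vectors and vector functionals -/

/-- The positive linear map `B → ℂ` underlying a functional that is nonnegative on all `x⋆x`. -/
noncomputable def WeakDual.toPositiveLinearMap [PartialOrder B] [StarOrderedRing B]
    (φ : WeakDual ℂ B) (hφ : ∀ x, 0 ≤ φ (star x * x)) : B →ₚ[ℂ] ℂ :=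
  PositiveLinearMap.mk₀ (WeakDual.toStrongDual φ).toLinearMap fun x hx => by
    obtain ⟨y, rfl⟩ := CStarAlgebra.nonneg_iff_eq_star_mul_self.1 hx
    exact hφ y

theorem WeakDual.toPositiveLinearMap_apply [PartialOrder B] [StarOrderedRing B]
    (φ : WeakDual ℂ B) (hφ : ∀ x, 0 ≤ φ (star x * x)) (x : B) :
    φ.toPositiveLinearMap hφ x = φ x := rfl

namespace PositiveLinearMap

variable [PartialOrder B] [StarOrderedRing B] (f : B →ₚ[ℂ] ℂ)

/-- The cyclic vector of the GNS representation of a positive functional on a unital C⋆-algebra: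
the class of `1`. -/
noncomputable def gnsVector : f.GNS := ((f.toPreGNS 1 : f.PreGNS) : f.GNS)

theorem gns_apply_gnsVector (x : B) :
    f.gnsNonUnitalStarAlgHom x f.gnsVector = ((f.toPreGNS x : f.PreGNS) : f.GNS) := by
  simp [gnsVector]

theorem inner_gnsVector (x : B) :
    ⟪f.gnsVector, f.gnsNonUnitalStarAlgHom x f.gnsVector⟫_ℂ = f x := by
  rw [gns_apply_gnsVector, gnsVector, UniformSpace.Completion.inner_coe, preGNS_inner_def]
  simp

theorem dense_range_gns_apply_gnsVector :
    DenseRange fun x : B => f.gnsNonUnitalStarAlgHom x f.gnsVector := by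
  have h : (fun x : B => f.gnsNonUnitalStarAlgHom x f.gnsVector)
      = ((↑) : f.PreGNS → f.GNS) ∘ f.toPreGNS := funext f.gns_apply_gnsVector
  rw [h]
  exact UniformSpace.Completion.denseRange_coe.comp f.toPreGNS.surjective.denseRange
    (UniformSpace.Completion.continuous_coe _)

/-- The GNS representation of `f` kills `j` as soon as `f` vanishes on the products `x * j * y`,
which give the matrix coefficients of `j` on the dense image of `B`. -/
theorem gns_apply_eq_zero {j : B} (h : ∀ x y, f (x * j * y) = 0) :
    f.gnsNonUnitalStarAlgHom j = 0 := by
  ext z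
  refine f.dense_range_gns_apply_gnsVector.induction_on z ?_ ?_
  · exact isClosed_eq (by fun_prop) (by fun_prop)
  · intro y
    rw [gns_apply_gnsVector, gnsNonUnitalStarAlgHom_apply_coe, _root_.zero_apply,
      ← norm_eq_zero, UniformSpace.Completion.norm_coe, preGNS_norm_def]
    simp [← mul_assoc, h]

end PositiveLinearMap

/-- The functional `x ↦ ⟨η, π(x) η⟩` on `B`. -/
noncomputable def vectorFunctional {H : Type*} [NormedAddCommGroup H] [InnerProductSpace ℂ H]
    [CompleteSpace H] (π : B →⋆ₙₐ[ℂ] (H →L[ℂ] H)) (η : H) : WeakDual ℂ B :=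
  StrongDual.toWeakDual <| LinearMap.mkContinuous
    { toFun := fun x => ⟪η, π x η⟫_ℂ
      map_add' := fun x y => by simp
      map_smul' := fun c x => by simp } (‖η‖ * ‖η‖) fun x => by
    refine (norm_inner_le_norm _ _).trans ?_
    have h := (π x).le_of_opNorm_le (NonUnitalStarAlgHom.norm_apply_le π x) η
    calc ‖η‖ * ‖π x η‖ ≤ ‖η‖ * (‖x‖ * ‖η‖) := by gcongr
      _ = ‖η‖ * ‖η‖ * ‖x‖ := by ring

section VectorFunctional

variable {H : Type*} [NormedAddCommGroup H] [InnerProductSpace ℂ H] [CompleteSpace H]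
  (π : B →⋆ₙₐ[ℂ] (H →L[ℂ] H)) (η : H)

theorem vectorFunctional_apply (x : B) : vectorFunctional π η x = ⟪η, π x η⟫_ℂ := rfl

theorem CStarIdeal.smul_vectorFunctional_mem_states (J : CStarIdeal B) {π : B →⋆ₙₐ[ℂ] (H →L[ℂ] H)}
    (h1 : π 1 = 1) (hJ : ∀ j ∈ J, π j = 0) {η : H} (hη : η ≠ 0) :
    (‖η‖ ^ 2)⁻¹ • vectorFunctional π η ∈ J.states := by
  have h : ∀ x, ((‖η‖ ^ 2)⁻¹ • vectorFunctional π η) x = (((‖η‖ ^ 2)⁻¹ : ℝ) : ℂ) * ⟪η, π x η⟫_ℂ :=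
    fun x => rfl
  refine ⟨?_, fun x => ?_, fun j hj => ?_⟩
  · rw [h, h1, one_apply_eq_self, inner_self_eq_norm_sq_to_K]
    have : ‖η‖ ^ 2 ≠ 0 := by positivity
    rw [RCLike.ofReal_eq_complex_ofReal, ← Complex.ofReal_pow, ← Complex.ofReal_mul,
      inv_mul_cancel₀ this, Complex.ofReal_one]
  · rw [h, map_mul, map_star, mul_apply_eq_comp, ContinuousLinearMap.star_eq_adjoint,
      ContinuousLinearMap.adjoint_inner_right, inner_self_eq_norm_sq_to_K]
    have : 0 ≤ (‖η‖ ^ 2)⁻¹ * ‖π x η‖ ^ 2 := by positivity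
    rw [RCLike.ofReal_eq_complex_ofReal, ← Complex.ofReal_pow, ← Complex.ofReal_mul]
    exact_mod_cast this
  · rw [h, hJ j hj]
    simp

/-- The orthogonal complement of an invariant subspace is again invariant, because `π` preserves
`star`; here in the form of vanishing matrix coefficients. -/
theorem inner_eq_zero_of_invariant {K : Submodule ℂ H} (hK : ∀ a : B, ∀ x ∈ K, π a x ∈ K)
    {x y : H} (hx : x ∈ K) (hy : y ∈ Kᗮ) (a : B) : ⟪x, π a y⟫_ℂ = 0 := by
  rw [← ContinuousLinearMap.adjoint_inner_left, ← ContinuousLinearMap.star_eq_adjoint, ← map_star]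
  exact hy _ (hK _ _ hx)

end VectorFunctional

/-! ### Extreme states give irreducible representations -/

/-- A unital cyclic representation whose vector state `φ` is extreme among the states vanishing on
`J` is irreducible: an invariant subspace `K` splits `ξ = p + q` with `p ∈ K`, `q ∈ Kᗮ`, and `φ`
into the vector functionals of `p` and `q`. By extremality the first one is `‖p‖² φ`, so that
`p = ‖p‖² ξ` as `ξ` is cyclic. -/
theorem CStarIdeal.isIrreducibleRep_of_mem_extremePoints (J : CStarIdeal B)
    {φ : WeakDual ℂ B} (hφ : φ ∈ J.states.extremePoints ℝ) {H : Type*} [NormedAddCommGroup H] [InnerProductSpace ℂ H]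
    [CompleteSpace H] {π : B →⋆ₙₐ[ℂ] (H →L[ℂ] H)} (h1 : π 1 = 1) (hJ : ∀ j ∈ J, π j = 0) {ξ : H}
    (hξ : DenseRange fun x => π x ξ) (hπ : vectorFunctional π ξ = φ) :
    IsIrreducibleRep π := by
  have hφ1 : ‖ξ‖ ^ 2 = 1 := by
    have h : ⟪ξ, π 1 ξ⟫_ℂ = 1 := by
      rw [← vectorFunctional_apply, hπ]
      exact hφ.1.1
    rw [h1, one_apply_eq_self, inner_self_eq_norm_sq_to_K,
      RCLike.ofReal_eq_complex_ofReal] at h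
    exact_mod_cast h
  refine ⟨fun h0 => ?_, fun K hKc hK => ?_⟩
  · have h : ξ = (1 : H →L[ℂ] H) ξ := rfl
    rw [← h1, h0] at h
    simp [show ξ = 0 from h] at hφ1
  have : CompleteSpace K := hKc.completeSpace_coe
  obtain ⟨p, hp, q, hq, hpq⟩ := K.exists_add_mem_mem_orthogonal ξ
  have hpq0 : ⟪p, q⟫_ℂ = 0 := hq p hp
  have hsplit : ∀ x, ⟪p, π x ξ⟫_ℂ = ⟪p, π x p⟫_ℂ := fun x => by
    rw [hpq, map_add, inner_add_right, inner_eq_zero_of_invariant π hK hp hq, add_zero]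
  have htop : ξ ∈ K → K = ⊤ := fun h => by
    rw [eq_top_iff]
    rintro z -
    exact hξ.induction_on z hKc fun x => hK x ξ h
  by_cases hp0 : p = 0
  · left
    rw [eq_bot_iff]
    intro k hk
    have hk0 : ∀ z, ⟪k, z⟫_ℂ = 0 := fun z => by
      refine hξ.induction_on z (isClosed_eq (by fun_prop) (by fun_prop)) fun x => ?_
      rw [hpq, hp0, zero_add]
      exact inner_eq_zero_of_invariant π hK hk hq x
    exact inner_self_eq_zero.1 (hk0 k)
  right
  apply htop
  by_cases hq0 : q = 0
  · rwa [hpq, hq0, add_zero]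
  have hnorm : ‖p‖ ^ 2 + ‖q‖ ^ 2 = 1 := by
    rw [← hφ1, hpq]
    simpa [sq] using (norm_add_sq_eq_norm_sq_add_norm_sq_of_inner_eq_zero p q hpq0).symm
  have hpp : 0 < ‖p‖ ^ 2 := by positivity
  have hqq : 0 < ‖q‖ ^ 2 := by positivity
  have hsum : vectorFunctional π p + vectorFunctional π q = φ := by
    rw [← hπ]
    refine DFunLike.ext _ _ fun x => ?_
    change ⟪p, π x p⟫_ℂ + ⟪q, π x q⟫_ℂ = ⟪ξ, π x ξ⟫_ℂ
    nth_rewrite 1 [hpq]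
    have hqp : ⟪q, π x p⟫_ℂ = 0 :=
      K.inner_left_of_mem_orthogonal (hK x p hp) hq
    rw [inner_add_left, hsplit, hpq, map_add, inner_add_right, hqp, zero_add]
  have hext := (mem_extremePoints.1 hφ).2 _ (J.smul_vectorFunctional_mem_states h1 hJ hp0) _
    (J.smul_vectorFunctional_mem_states h1 hJ hq0)
    ⟨‖p‖ ^ 2, ‖q‖ ^ 2, hpp, hqq, hnorm, by
      rw [← hsum]
      exact congrArg₂ _ (smul_inv_smul₀ hpp.ne' _) (smul_inv_smul₀ hqq.ne' _)⟩
  have hpx : ∀ x, ⟪p, π x ξ⟫_ℂ = ((‖p‖ ^ 2 : ℝ) : ℂ) * ⟪ξ, π x ξ⟫_ℂ := fun x => by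
    have h : ⟪ξ, π x ξ⟫_ℂ = (((‖p‖ ^ 2)⁻¹ : ℝ) : ℂ) * ⟪p, π x p⟫_ℂ := by
      rw [← vectorFunctional_apply, hπ, ← hext.1]
      rfl
    rw [hsplit, h, ← mul_assoc, ← Complex.ofReal_mul, mul_inv_cancel₀ hpp.ne', Complex.ofReal_one,
      one_mul]
  have hpξ : p - ((‖p‖ ^ 2 : ℝ) : ℂ) • ξ = 0 := by
    have h0 : ∀ z, ⟪p - ((‖p‖ ^ 2 : ℝ) : ℂ) • ξ, z⟫_ℂ = 0 := fun z => by
      refine hξ.induction_on z (isClosed_eq (by fun_prop) (by fun_prop)) fun x => ?_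
      rw [inner_sub_left, inner_smul_left, Complex.conj_ofReal, hpx, sub_self]
    exact inner_self_eq_zero.1 (h0 _)
  have hne : ((‖p‖ ^ 2 : ℝ) : ℂ) ≠ 0 := by exact_mod_cast hpp.ne'
  rw [← inv_smul_smul₀ hne ξ, ← sub_eq_zero.1 hpξ]
  exact K.smul_mem _ hp

/-- Banach–Alaoglu; a state has norm at most one by the Cauchy–Schwarz inequality in its GNS
representation. -/
theorem CStarIdeal.isCompact_states [PartialOrder B] [StarOrderedRing B]
    (J : CStarIdeal B) : IsCompact J.states := by
  refine (WeakDual.isCompact_closedBall (𝕜 := ℂ) (E := B) 0 1).of_isClosed_subset ?_ ?_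
  · have h : J.states = {φ : WeakDual ℂ B | φ 1 = 1} ∩ ((⋂ x, {φ | 0 ≤ φ (star x * x)}) ∩
        ⋂ j ∈ J, {φ | φ j = 0}) := by
      ext φ
      simp [states]
    have hc : ∀ x : B, Continuous fun φ : WeakDual ℂ B => φ x := WeakDual.eval_continuous
    rw [h]
    exact (isClosed_eq (hc _) continuous_const).inter
      ((isClosed_iInter fun x => isClosed_le continuous_const (hc _)).inter
      (isClosed_biInter fun j _ => isClosed_eq (hc _) continuous_const))
  · rintro φ ⟨h1, h2, -⟩
    rw [Set.mem_preimage, mem_closedBall_zero_iff]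
    refine ContinuousLinearMap.opNorm_le_bound _ zero_le_one fun x => ?_
    set f := φ.toPositiveLinearMap h2
    change ‖f x‖ ≤ 1 * ‖x‖
    have hξ : ‖f.gnsVector‖ = 1 := by
      rw [PositiveLinearMap.gnsVector, UniformSpace.Completion.norm_coe,
        PositiveLinearMap.preGNS_norm_def]
      simp [f, WeakDual.toPositiveLinearMap_apply, h1]
    rw [← f.inner_gnsVector]
    refine (norm_inner_le_norm _ _).trans ?_
    have h := (f.gnsNonUnitalStarAlgHom x).le_of_opNorm_le
      (NonUnitalStarAlgHom.norm_apply_le _ x) f.gnsVector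
    simpa [hξ] using h

end Unital

universe u

/-! ### Irreducible representations that separate an ideal from an element -/

theorem WeakDual.locallyConvexSpace_real (B : Type*) [CStarAlgebra B] :
    LocallyConvexSpace ℝ (WeakDual ℂ B) :=
  LocallyConvexSpace.induced (F := B → ℂ)
    ({ toFun := fun φ x => φ x
       map_add' := fun _ _ => rfl
       map_smul' := fun _ _ => rfl } : WeakDual ℂ B →ₗ[ℝ] (B → ℂ))

/-- The Krein–Milman theorem in the weak-⋆ dual of a complex algebra, viewed as a real space. -/
theorem WeakDual.closure_convexHull_extremePoints {B : Type*} [CStarAlgebra B]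
    {s : Set (WeakDual ℂ B)} (hs : IsCompact s) (hconv : Convex ℝ s) :
    closure (convexHull ℝ (s.extremePoints ℝ)) = s := by
  have := WeakDual.locallyConvexSpace_real B
  -- `ℝ` acts on `WeakDual ℂ B` through two instance paths that are equal only after unfolding
  -- beyond what instance search does, so the continuity of the action is passed explicitly.
  exact @_root_.closure_convexHull_extremePoints (WeakDual ℂ B) _ _ _ _ _
    (WeakDual.instContinuousSMul ℝ) this s hs hconv

/-- A point at which some functional of a weak-⋆ compact convex set is nonzero is not killed by all
extreme points of the set: the functionals vanishing at it form a closed convex set. -/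
theorem WeakDual.exists_mem_extremePoints_apply_ne_zero {B : Type*} [CStarAlgebra B]
    {s : Set (WeakDual ℂ B)} (hs : IsCompact s) (hconv : Convex ℝ s) {φ₀ : WeakDual ℂ B}
    (hφ₀ : φ₀ ∈ s) {x : B} (hx : φ₀ x ≠ 0) : ∃ φ ∈ s.extremePoints ℝ, φ x ≠ 0 := by
  have hcl : IsClosed {φ : WeakDual ℂ B | φ x = 0} :=
    isClosed_eq (WeakDual.eval_continuous _) continuous_const
  have hker : Convex ℝ {φ : WeakDual ℂ B | φ x = 0} := by
    intro φ h1 ψ h2 s t _ _ _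
    change (s : ℂ) * φ x + (t : ℂ) * ψ x = 0
    rw [show φ x = 0 from h1, show ψ x = 0 from h2]
    simp
  by_contra! hcon
  rw [← WeakDual.closure_convexHull_extremePoints hs hconv] at hφ₀
  have hsub : convexHull ℝ (s.extremePoints ℝ) ⊆ {φ : WeakDual ℂ B | φ x = 0} :=
    convexHull_min hcon hker
  have hsub' : closure (convexHull ℝ (s.extremePoints ℝ)) ⊆ {φ : WeakDual ℂ B | φ x = 0} :=
    closure_minimal hsub hcl
  exact hx (hsub' hφ₀)

/-- In a unital C⋆-algebra, a closed ideal `J` and an element `a ∉ J` are separated by an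
irreducible representation, namely the GNS representation of an extreme state. -/
theorem CStarIdeal.exists_isIrreducibleRep {B : Type u} [CStarAlgebra B] (J : CStarIdeal B)
    {a : B} (ha : a ∉ J) :
    ∃ (H : Type u) (_ : NormedAddCommGroup H) (_ : InnerProductSpace ℂ H) (_ : CompleteSpace H)
      (π : B →⋆ₙₐ[ℂ] (H →L[ℂ] H)),
      IsIrreducibleRep π ∧ π 1 = 1 ∧ (∀ j ∈ J, π j = 0) ∧ π a ≠ 0 := by
  let _ := CStarAlgebra.spectralOrder B
  have := CStarAlgebra.spectralOrderedRing B
  obtain ⟨φ₀, hφ₀, hφ₀a⟩ := J.exists_mem_states ha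
  obtain ⟨φ, hφ, hφa⟩ := WeakDual.exists_mem_extremePoints_apply_ne_zero J.isCompact_states
    J.convex_states hφ₀ hφ₀a
  set f := φ.toPositiveLinearMap hφ.1.2.1
  have hf : ∀ x, f x = φ x := fun _ => rfl
  have h1 : f.gnsNonUnitalStarAlgHom 1 = 1 := f.gnsStarAlgHom.map_one'
  have hJ : ∀ j ∈ J, f.gnsNonUnitalStarAlgHom j = 0 := fun j hj =>
    f.gns_apply_eq_zero fun x y => hφ.1.2.2 _ (J.mul_mem_right' _ (J.mul_mem_left' _ hj))
  refine ⟨f.GNS, inferInstance, inferInstance, inferInstance, f.gnsNonUnitalStarAlgHom, ?_, h1, hJ,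
    fun h0 => hφa ?_⟩
  · exact J.isIrreducibleRep_of_mem_extremePoints hφ h1 hJ f.dense_range_gns_apply_gnsVector
      (DFunLike.ext _ _ f.inner_gnsVector)
  · rw [← hf, ← f.inner_gnsVector, map_mul, h0]
    simp

/-! ### Ideals as intersections of primitive ideals -/

section Primitive

variable {A : Type u} [NonUnitalCStarAlgebra A]

namespace CStarIdeal

/-- An ideal of `A`, regarded as an ideal of the unitization of `A`. -/
noncomputable def toUnitization (I : CStarIdeal A) : CStarIdeal (Unitization ℂ A) where
  toSubmodule := I.toSubmodule.map (Unitization.inrHom ℂ ℂ A)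
  mul_mem_left' := by
    rintro a _ ⟨x, hx, rfl⟩
    refine ⟨a.fst • x + a.snd * x, I.add_mem' (I.smul_mem' _ hx) (I.mul_mem_left' _ hx), ?_⟩
    ext <;> simp
  mul_mem_right' := by
    rintro a _ ⟨x, hx, rfl⟩
    refine ⟨a.fst • x + x * a.snd, I.add_mem' (I.smul_mem' _ hx) (I.mul_mem_right' _ hx), ?_⟩
    ext <;> simp
  isClosed' :=
    (Unitization.isometry_inr (𝕜 := ℂ) (A := A)).isClosedEmbedding.isClosedMap _ I.isClosed'

theorem inr_mem_toUnitization {I : CStarIdeal A} {a : A} :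
    (a : Unitization ℂ A) ∈ I.toUnitization ↔ a ∈ I :=
  ⟨fun ⟨_, hx, h⟩ => Unitization.inr_injective h ▸ hx, fun h => ⟨a, h, rfl⟩⟩

/-- A closed ideal `I` and an element `a ∉ I` are separated by a primitive ideal. An irreducible
representation of the unitization, nonzero at `a`, stays irreducible on `A`, because the
unitization is spanned by `A` and `1`. -/
theorem exists_primitiveIdeal (I : CStarIdeal A) {a : A} (ha : a ∉ I) :
    ∃ P : PrimitiveIdealSpace A, I ≤ P.1 ∧ a ∉ P.1 := by
  obtain ⟨H, _, _, _, π, ⟨-, hirr⟩, h1, hI, hπa⟩ :=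
    I.toUnitization.exists_isIrreducibleRep (mt inr_mem_toUnitization.1 ha)
  let ρ : A →⋆ₙₐ[ℂ] (H →L[ℂ] H) := π.comp (Unitization.inrNonUnitalStarAlgHom ℂ A)
  have hρ : ∀ x, ρ x = π x := fun _ => rfl
  let P : CStarIdeal A :=
    { carrier := {x | ρ x = 0}
      add_mem' := fun {x y} hx hy => by
        change ρ (x + y) = 0
        rw [map_add, show ρ x = 0 from hx, show ρ y = 0 from hy, add_zero]
      zero_mem' := map_zero ρ
      smul_mem' := fun c x hx => by
        change ρ (c • x) = 0
        rw [map_smul, show ρ x = 0 from hx, smul_zero]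
      mul_mem_left' := fun a x hx => by
        change ρ (a * x) = 0
        rw [map_mul, show ρ x = 0 from hx, mul_zero]
      mul_mem_right' := fun a x hx => by
        change ρ (x * a) = 0
        rw [map_mul, show ρ x = 0 from hx, zero_mul]
      isClosed' := isClosed_eq
        (AddMonoidHomClass.continuous_of_bound ρ 1 fun x => by
          simpa using NonUnitalStarAlgHom.norm_apply_le ρ x) continuous_const }
  refine ⟨⟨P, H, _, _, _, ρ, ⟨fun h => hπa ?_, fun K hKc hK => hirr K hKc fun b x hx => ?_⟩,
    fun _ => Iff.rfl⟩, fun x hx => hI _ (inr_mem_toUnitization.2 hx), hπa⟩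
  · rw [← hρ, h]
    rfl
  · have hb : π b = b.fst • (1 : H →L[ℂ] H) + ρ b.snd := by
      rw [hρ, ← h1, ← map_smul, ← map_add]
      congr 1
      ext <;> simp
    rw [hb]
    exact K.add_mem (K.smul_mem _ hx) (hK _ _ hx)

/-- Every closed ideal is the intersection of the primitive ideals that contain it. -/
theorem kernel_setOf_le (I : CStarIdeal A) :
    PrimitiveIdealSpace.kernel {P : PrimitiveIdealSpace A | I ≤ P.1} = I := by
  refine le_antisymm (fun a ha => ?_) (PrimitiveIdealSpace.le_kernel fun _ hP => hP)
  by_contra hn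
  obtain ⟨P, hP, haP⟩ := I.exists_primitiveIdeal hn
  exact haP (PrimitiveIdealSpace.kernel_le (S := {P | I ≤ P.1}) hP ha)

end CStarIdeal

namespace PrimitiveIdealSpace

theorem kernel_union (S T : Set (PrimitiveIdealSpace A)) :
    kernel (S ∪ T) = kernel S ⊓ kernel T := by
  refine le_antisymm (le_inf (le_kernel fun P hP => kernel_le (.inl hP))
    (le_kernel fun P hP => kernel_le (.inr hP))) (le_kernel ?_)
  rintro P (hP | hP)
  · exact inf_le_left.trans (kernel_le hP)
  · exact inf_le_right.trans (kernel_le hP)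

theorem isOpen_setOf_not_le (I : CStarIdeal A) :
    IsOpen {P : PrimitiveIdealSpace A | ¬ I ≤ P.1} := fun _ hP hn =>
  hn (le_trans (le_kernel fun _ hQ => not_not.1 hQ) hP)

theorem not_kernel_compl_le_iff {U : Set (PrimitiveIdealSpace A)} (hU : IsOpen U)
    (P : PrimitiveIdealSpace A) : ¬ kernel Uᶜ ≤ P.1 ↔ P ∈ U :=
  ⟨fun h => by_contra fun hP => h (kernel_le hP), fun hP h => hU P h hP⟩

end PrimitiveIdealSpace

end Primitive

/-! ### The correspondence between actions and continuous maps -/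

section Correspondence

variable {E : Type*} [SemilatticeInf E] [BoundedOrder E] {A : Type u} [NonUnitalCStarAlgebra A]

open Classical in
/-- The character `e ↦ [α(e) ⊄ P]` of `E` attached to an action `α` and a primitive ideal `P`. It
is multiplicative because primitive ideals are prime. -/
noncomputable def SemilatticeAction.character (α : SemilatticeAction E A)
    (P : PrimitiveIdealSpace A) : CharacterSpace E where
  toFun e := decide (¬ α e ≤ P.1)
  map_inf' e f := by
    have h : α (e ⊓ f) ≤ P.1 ↔ α e ≤ P.1 ∨ α f ≤ P.1 := by
      rw [show α (e ⊓ f) = α e ⊓ α f from α.map_inf' e f]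
      exact ⟨P.2.le_or_le, fun h => h.elim inf_le_left.trans inf_le_right.trans⟩
    rw [Bool.eq_iff_iff]
    simp [h]
  map_top' := by
    rw [show α ⊤ = ⊤ from α.map_top']
    simpa using P.2.not_top_le
  map_bot' := by
    rw [show α ⊥ = ⊥ from α.map_bot']
    simp

open Classical in
theorem SemilatticeAction.character_eq_true_iff (α : SemilatticeAction E A)
    (P : PrimitiveIdealSpace A) (e : E) : α.character P e = true ↔ ¬ α e ≤ P.1 :=
  decide_eq_true_iff

/-- The structure of C⋆-algebra over the character space given by an action of `E`. -/
noncomputable def SemilatticeAction.toCStarAlgebraOver (α : SemilatticeAction E A) :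
    CStarAlgebraOver (CharacterSpace E) A where
  toFun := α.character
  continuous_toFun := by
    refine continuous_generateFrom_iff.2 ?_
    rintro _ ⟨e, rfl⟩
    convert PrimitiveIdealSpace.isOpen_setOf_not_le (α e) using 1
    ext P
    exact α.character_eq_true_iff P e

/-- The action `e ↦ A(U_e)` of `E` given by a structure of C⋆-algebra over its character space. -/
def CStarAlgebraOver.toSemilatticeAction (ψ : CStarAlgebraOver (CharacterSpace E) A) :
    SemilatticeAction E A where
  toFun e := ψ.idealOver (CharacterSpace.basicOpen e)
  map_inf' e f := by
    rw [idealOver, idealOver, idealOver, ← PrimitiveIdealSpace.kernel_union, ← Set.compl_inter]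
    congr 2
    ext P
    change (ψ P) (e ⊓ f) = true ↔ (ψ P) e = true ∧ (ψ P) f = true
    rw [show (ψ P) (e ⊓ f) = (ψ P e ⊓ ψ P f) from (ψ P).map_inf' e f]
    exact Bool.and_eq_true_iff
  map_top' := by
    refine top_le_iff.1 (PrimitiveIdealSpace.le_kernel fun P hP => (hP ?_).elim)
    exact (ψ P).map_top'
  map_bot' := by
    rw [idealOver, ← CStarIdeal.kernel_setOf_le ⊥]
    congr 1
    ext P
    refine iff_of_true (fun h => ?_) (bot_le (a := P.1))
    exact Bool.false_ne_true ((ψ P).map_bot'.symm.trans h)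

end Correspondence

/-- Actions of a semilattice `E` with unit and zero on a C⋆-algebra `A` are equivalent to
structures of C⋆-algebra over the character space of `E` on `A`. The action `α` corresponds to the
map that sends a primitive ideal `P` to the character `e ↦ [α(e) ⊄ P]`, and the structure `ψ`
corresponds to the action `e ↦ A(U_e)`. -/
theorem proposition2 (E : Type*) [SemilatticeInf E] [BoundedOrder E]
    (A : Type*) [NonUnitalCStarAlgebra A] :
    ∃ Φ : SemilatticeAction E A ≃ CStarAlgebraOver (CharacterSpace E) A,
      (∀ (α : SemilatticeAction E A) (P : PrimitiveIdealSpace A) (e : E),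
        (Φ α P) e = true ↔ ¬ α e ≤ P.1) ∧
      (∀ (ψ : CStarAlgebraOver (CharacterSpace E) A) (e : E),
        (Φ.symm ψ) e = CStarAlgebraOver.idealOver ψ (CharacterSpace.basicOpen e)) := by
  refine ⟨⟨SemilatticeAction.toCStarAlgebraOver, CStarAlgebraOver.toSemilatticeAction,
    fun α => DFunLike.ext _ _ fun e => ?_, fun ψ => DFunLike.ext _ _ fun P =>
      DFunLike.ext _ _ fun e => ?_⟩, fun α => α.character_eq_true_iff, fun _ _ => rfl⟩
  · refine Eq.trans ?_ (α e).kernel_setOf_le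
    change PrimitiveIdealSpace.kernel _ = _
    congr 1
    ext P
    exact (not_congr (α.character_eq_true_iff P e)).trans not_not
  · rw [Bool.eq_iff_iff]
    refine (SemilatticeAction.character_eq_true_iff _ P e).trans ?_
    exact PrimitiveIdealSpace.not_kernel_compl_le_iff
      ((CharacterSpace.basicOpen e).isOpen.preimage ψ.continuous) P
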